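/- Let $K$ be a field, $E=(E^0,E^1,r,s)$ a finite directed graph and $L=L_K(E)$ its Leavitt path algebra (with relation (CK2), $v=\sum_{s(e)=v}ee^*$, imposed at every vertex $v$ that emits at least one edge), graded by $\mathbb Z$ via $\deg(\alpha\beta^*)=|\alpha|-|\beta|$. Ideals are two-sided. A *closed simple path* based at $v$ is a path $e_1\cdots e_n$, $n\ge 1$, from $v$ to $v$ with $s(e_i)\neq v$ for $i\ge 2$. A *K1 cycle* is a cycle $\lambda$ that is the only closed simple path based at its base vertex $v$; for $p\in K[x]$, $p(\lambda)\in L$ is formed with $\lambda^0=v$. Let $\lambda_1,\dots,\lambda_m$ be a list of all K1 cycles of $E$, each taken once up to the choice of its base vertex. An ideal of $L$ is *$\lambda$-reducible* if it is generated by some set of elements $p(\lambda)$, with $p\in K[x]$ and $\lambda$ a K1 cycle, together with a (possibly empty) hereditary saturated set of vertices. A *$\lambda$-reduction* of an ideal $J$ consists of the vertex set $J\cap E^0$ and polynomials $p_1,\dots,p_m\in K[x]$ such that 1. for each $i$, either $p_i=0$, or $p_i$ is monic and non-constant with nonzero constant term and the base vertex of $\lambda_i$ does not lie in $J$; 2.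 $J$ is generated by $\{p_i(\lambda_i)\}_{1\le i\le m}\cup (J\cap E^0)$. **Proposition.** Let $I$ and $I'$ be non-graded $\lambda$-reducible ideals of $L$. Then each of $I$ and $I'$ has a unique $\lambda$-reduction. If, moreover, these $\lambda$-reductions have the same vertex set, that is, $I\cap E^0=I'\cap E^0$, and $p_1,\dots,p_m$ and $p_1',\dots,p_m'$ are their polynomials, then $$I\subseteq I'\iff p_i'\mid p_i \text{ in } K[x]\text{ for every } i\in\{1,\dots,m\}.$$ -/

import Mathlib

open Polynomial

/-- A directed graph (loops and multiple edges allowed) with vertex set `V`, edge set `E`,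
source map `src` and range map `rng`. -/
structure DirectedGraph (V E : Type*) where
  src : E → V
  rng : E → V

namespace DirectedGraph

variable {V E : Type*}

/-- `G.IsPath u l w`: the list of edges `l` is a path of `G` from `u` to `w`.
The empty list is the path of degree zero at a vertex. -/
def IsPath (G : DirectedGraph V E) : V → List E → V → Prop
  | u, [], w => u = w
  | u, e :: l, w => G.src e = u ∧ G.IsPath (G.rng e) l w

/-- `e₁ ⋯ eₙ` with `n ≥ 1` is a closed path based at `v` and `s(eᵢ) ≠ v` for `i ≥ 2`. -/
def IsClosedSimplePath (G : DirectedGraph V E) (v : V) (l : List E) : Prop :=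
  l ≠ [] ∧ G.IsPath v l v ∧ ∀ e ∈ l.tail, G.src e ≠ v

/-- A closed simple path based at `v` whose edges have pairwise distinct sources. -/
def IsCycle (G : DirectedGraph V E) (v : V) (l : List E) : Prop :=
  G.IsClosedSimplePath v l ∧ (l.map G.src).Nodup

/-- A K1 cycle: a cycle which is the only closed simple path based at its base vertex. -/
structure K1Cycle (G : DirectedGraph V E) where
  base : V
  edges : List E
  isCycle : G.IsCycle base edges
  unique : ∀ l, G.IsClosedSimplePath base l → l = edges

/-- `lam` lists all K1 cycles of `G`, each exactly once up to the choice of the base vertex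
(that is, up to cyclic rotation). -/
def ListsK1Cycles (G : DirectedGraph V E) {m : ℕ} (lam : Fin m → G.K1Cycle) : Prop :=
  ∀ c : G.K1Cycle, ∃! i : Fin m, c.edges.IsRotated (lam i).edges

def IsHereditary (G : DirectedGraph V E) (X : Set V) : Prop :=
  ∀ v w l, v ∈ X → G.IsPath v l w → w ∈ X

def IsSaturated (G : DirectedGraph V E) (X : Set V) : Prop :=
  ∀ v, (∃ e, G.src e = v) → (∀ e, G.src e = v → G.rng e ∈ X) → v ∈ X

/-- The generators of the Leavitt path algebra: vertices, edges and ghost edges. -/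
inductive Generator (V E : Type*)
  | vertex : V → Generator V E
  | edge : E → Generator V E
  | ghost : E → Generator V E

open FreeAlgebra Generator in
open scoped Classical in
/-- The defining relations of the Leavitt path algebra of a finite graph. The relation `one` says
that the sum of the vertices is the unit: for a finite graph the non-unital algebra on these
generators with the remaining relations has that sum as its unit, so imposing `one` in the
free unital algebra presents the same algebra. -/
inductive LeavittRel (K : Type*) [Field K] [Fintype V] [Fintype E] (G : DirectedGraph V E) :
    FreeAlgebra K (Generator V E) → FreeAlgebra K (Generator V E) → Prop
  | one : LeavittRel K G (∑ v : V, ι K (vertex v)) 1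
  | vertex_mul_self (v : V) :
      LeavittRel K G (ι K (vertex v) * ι K (vertex v)) (ι K (vertex v))
  | vertex_mul_of_ne (v w : V) (h : v ≠ w) :
      LeavittRel K G (ι K (vertex v) * ι K (vertex w)) 0
  | edge_mul_rng (e : E) :
      LeavittRel K G (ι K (edge e) * ι K (vertex (G.rng e))) (ι K (edge e))
  | src_mul_edge (e : E) :
      LeavittRel K G (ι K (vertex (G.src e)) * ι K (edge e)) (ι K (edge e))
  | ghost_mul_src (e : E) :
      LeavittRel K G (ι K (ghost e) * ι K (vertex (G.src e))) (ι K (ghost e))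
  | rng_mul_ghost (e : E) :
      LeavittRel K G (ι K (vertex (G.rng e)) * ι K (ghost e)) (ι K (ghost e))
  | ck1_self (e : E) :
      LeavittRel K G (ι K (ghost e) * ι K (edge e)) (ι K (vertex (G.rng e)))
  | ck1_of_ne (e f : E) (h : e ≠ f) :
      LeavittRel K G (ι K (ghost e) * ι K (edge f)) 0
  | ck2 (v : V) (h : ∃ e, G.src e = v) :
      LeavittRel K G (∑ e : E with G.src e = v, ι K (edge e) * ι K (ghost e)) (ι K (vertex v))

variable (K : Type*) [Field K] [Fintype V] [Fintype E] (G : DirectedGraph V E)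

/-- The Leavitt path algebra `L_K(G)` of the finite graph `G`. -/
def Leavitt : Type _ := RingQuot (LeavittRel K G)

namespace Leavitt

noncomputable instance : Ring (G.Leavitt K) := inferInstanceAs (Ring (RingQuot (LeavittRel K G)))

noncomputable instance : Algebra K (G.Leavitt K) :=
  inferInstanceAs (Algebra K (RingQuot (LeavittRel K G)))

/-- The image of a generator in `L_K(G)`. -/
noncomputable def gen (x : Generator V E) : G.Leavitt K :=
  RingQuot.mkAlgHom K (LeavittRel K G) (FreeAlgebra.ι K x)

noncomputable def vertex (v : V) : G.Leavitt K := gen K G (.vertex v)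

noncomputable def edge (e : E) : G.Leavitt K := gen K G (.edge e)

noncomputable def ghost (e : E) : G.Leavitt K := gen K G (.ghost e)

/-- The element `e₁ ⋯ eₙ` of a path `l = [e₁, …, eₙ]` starting at `u`
(the vertex `u` if `l` is empty). -/
noncomputable def path (u : V) (l : List E) : G.Leavitt K :=
  vertex K G u * (l.map (edge K G)).prod

/-- The element `eₙ* ⋯ e₁*` of a path `l = [e₁, …, eₙ]` starting at `u`
(the vertex `u` if `l` is empty). -/
noncomputable def ghostPath (u : V) (l : List E) : G.Leavitt K :=
  (l.map (ghost K G)).reverse.prod * vertex K G u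

/-- The homogeneous component of degree `n`: the span of the elements `α β*` with
`r(α) = r(β)` and `deg α - deg β = n`. -/
noncomputable def component (n : ℤ) : Submodule K (G.Leavitt K) :=
  Submodule.span K {x | ∃ (u v w : V) (α β : List E), G.IsPath u α w ∧ G.IsPath v β w ∧
    (α.length : ℤ) - (β.length : ℤ) = n ∧ x = path K G u α * ghostPath K G v β}

variable {K G}

/-- An ideal is graded if it contains the homogeneous components of each of its elements. -/
def IsGraded (I : TwoSidedIdeal (G.Leavitt K)) : Prop :=
  ∀ y : ℤ →₀ G.Leavitt K, (∀ n, y n ∈ component K G n) → (y.sum fun _ a => a) ∈ I →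
    ∀ n, y n ∈ I

/-- `I ∩ E⁰`. -/
def vertexSet (I : TwoSidedIdeal (G.Leavitt K)) : Set V := {v | vertex K G v ∈ I}

/-- `p(λ)`, where `λ⁰` is the base vertex of `λ`. The factor `vertex` turns the constant term of
`p` into a multiple of the base vertex and fixes the positive powers of `λ`. -/
noncomputable def evalCycle (c : G.K1Cycle) (p : K[X]) : G.Leavitt K :=
  vertex K G c.base * aeval (path K G c.base c.edges) p

/-- `I` is generated by polynomials in K1 cycles and a hereditary saturated set of vertices. -/
def IsLambdaReducible (I : TwoSidedIdeal (G.Leavitt K)) : Prop :=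
  ∃ (A : Set (K[X] × G.K1Cycle)) (S : Set V), G.IsHereditary S ∧ G.IsSaturated S ∧
    I = TwoSidedIdeal.span ((fun a => evalCycle a.2 a.1) '' A ∪ vertex K G '' S)

end Leavitt

open Leavitt

/-- A set of vertices and a family of polynomials indexed by the K1 cycles `λ₁, …, λₘ`. -/
structure LambdaData (K V : Type*) [Field K] (m : ℕ) where
  vertices : Set V
  poly : Fin m → K[X]

variable {K G}

/-- `D` is the `λ`-reduction of `I`: its vertex set is `I ∩ E⁰`, each polynomial `pᵢ` is either zero
(no polynomial of `λᵢ` occurs) or a monic `λ`-polynomial (nonzero constant term, not a monomial) of a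
cycle `λᵢ` that is not based at a vertex of `I`, and the `pᵢ(λᵢ)` together with the
vertices generate `I`. -/
structure IsLambdaReduction {m : ℕ} (lam : Fin m → G.K1Cycle) (I : TwoSidedIdeal (G.Leavitt K))
    (D : LambdaData K V m) : Prop where
  vertices_eq : D.vertices = vertexSet I
  poly_spec : ∀ i, D.poly i = 0 ∨
    ((D.poly i).Monic ∧ (D.poly i).coeff 0 ≠ 0 ∧ 0 < (D.poly i).natDegree ∧
      (lam i).base ∉ D.vertices)
  span_eq : I = TwoSidedIdeal.span
    (Set.range (fun i => evalCycle (lam i) (D.poly i)) ∪ vertex K G '' D.vertices)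

end DirectedGraph

/-! For an ideal $I$ and a K1 cycle $c$, the polynomials $p$ with $p(c)\in I$ form an ideal
`polyIdeal I c` of $K[x]$, hence a principal one. It is invariant under rotating $c$ and, as
$c^*c=v$, closed under cancelling $x$. If $v\notin I$, its monic generator, if nonzero, is therefore
non-constant with nonzero constant term. These generators give existence.

Uniqueness and the order both follow from `evalCycle_mem_iff`: if the base of $\lambda_i$ is not in
$I$, then $p(\lambda_i)\in I$ iff $p_i\mid p$. The hard direction, `dvd_of_evalCycle_mem`, needs a
representation that kills $I$ and detects $p_i$. Let $b$ be the base of $\lambda_i$, and let $L$ act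
on $A$-valued functions on the infinite paths whose vertices all connect to $b$, with the first edge
of $\lambda_i$ weighted by a unit $u\in A$ such that $q(u)=0$ iff $p_i\mid q$. At the path
$\lambda_i\lambda_i\cdots$, $p(\lambda_i)$ acts as $p(u)$. Vertices of $I$ act as zero because they
do not connect to $b$. If $p_j\ne0$, then $p_j(0)\neq 0$ forces the exits of $\lambda_j$ into $I$;
so for $j\ne i$ the base of $\lambda_j$ does not connect to $b$, and for $j=i$ the only infinite
path from $b$ is $\lambda_i\lambda_i\cdots$, where $p_i(u)=0$. -/

namespace DirectedGraph

/-! ### Paths, rotations and exits of K1 cycles. -/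

section Paths

variable {V E : Type*} {G : DirectedGraph V E}

theorem isPath_append {u w : V} {α β : List E} :
    G.IsPath u (α ++ β) w ↔ ∃ v, G.IsPath u α v ∧ G.IsPath v β w := by
  induction α generalizing u with
  | nil => simp [IsPath]
  | cons e α ih => simp [IsPath, ih, and_assoc]

theorem IsPath.source_eq {u v w w' : V} {l : List E} (hl : l ≠ []) (h : G.IsPath u l w)
    (h' : G.IsPath v l w') : u = v := by
  cases l with
  | nil => exact absurd rfl hl
  | cons e l => exact h.1.symm.trans h'.1

/-- Two K1 cycles that are rotations of each other, split at their base vertices. -/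
theorem K1Cycle.exists_split_of_isRotated {c d : G.K1Cycle} (h : c.edges.IsRotated d.edges) :
    ∃ α β, c.edges = α ++ β ∧ d.edges = β ++ α ∧ G.IsPath c.base α d.base ∧
      G.IsPath d.base β c.base := by
  obtain ⟨n, hn⟩ := h
  have hc := c.isCycle.1.2.1
  have hd := d.isCycle.1.2.1
  rw [← List.rotate_mod] at hn
  have hlt : n % c.edges.length ≤ c.edges.length :=
    (Nat.mod_lt _ (List.length_pos_of_ne_nil c.isCycle.1.1)).le
  rw [List.rotate_eq_drop_append_take hlt] at hn
  set α := c.edges.take (n % c.edges.length) with hα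
  set β := c.edges.drop (n % c.edges.length) with hβ
  have hsplit : c.edges = α ++ β := (List.take_append_drop _ _).symm
  rw [hsplit, isPath_append] at hc
  obtain ⟨w, h₁, h₂⟩ := hc
  have hw : G.IsPath w (β ++ α) w := isPath_append.2 ⟨_, h₂, h₁⟩
  rw [hn] at hw
  obtain rfl := hw.source_eq d.isCycle.1.1 hd
  exact ⟨α, β, hsplit, hn.symm, h₁, h₂⟩

/-- A K1 cycle passing through the base vertex of another one is a rotation of it. -/
theorem K1Cycle.isRotated_of_base_mem {c d : G.K1Cycle} (h : d.base ∈ c.edges.map G.src) :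
    d.edges.IsRotated c.edges := by
  obtain ⟨e, he, hed⟩ := List.mem_map.1 h
  obtain ⟨α, β, hsplit⟩ := List.append_of_mem he
  have hc := c.isCycle.1.2.1
  rw [hsplit, isPath_append] at hc
  obtain ⟨w, h₁, h₂⟩ := hc
  have hw : w = d.base := h₂.1.symm.trans hed
  subst hw
  have hnodup := c.isCycle.2
  rw [hsplit] at hnodup
  -- Rotated to start at `d.base`, the cycle `c` is a closed simple path there, so it is the only
  -- one.
  have key : e :: β ++ α = d.edges := by
    apply d.unique
    refine ⟨by simp, isPath_append.2 ⟨_, h₂, h₁⟩, ?_⟩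
    intro f hf hfe
    have hf' : f ∈ β ∨ f ∈ α := by simpa using hf
    have hperm : ((e :: β ++ α).map G.src).Nodup :=
      (List.Perm.nodup_iff ((List.perm_append_comm).map _)).1 hnodup
    simp only [List.cons_append, List.map_cons, List.nodup_cons] at hperm
    apply hperm.1
    rw [hed, ← hfe]
    exact List.mem_map_of_mem (by simpa using hf')
  rw [← key, hsplit]
  exact List.isRotated_append

/-- The edge of a K1 cycle `c` at position `n` of the infinite path `c c c ⋯`. -/
def K1Cycle.edgeAt (c : G.K1Cycle) (n : ℕ) : E :=
  c.edges[n % c.edges.length]'(Nat.mod_lt _ (List.length_pos_of_ne_nil c.isCycle.1.1))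

theorem IsPath.rng_getElem {u w : V} {l : List E} (h : G.IsPath u l w) {n : ℕ}
    (hn : n + 1 < l.length) : G.rng l[n] = G.src l[n + 1] := by
  induction l generalizing u n with
  | nil => simp at hn
  | cons e l ih =>
    cases n with
    | zero =>
      cases l with
      | nil => simp at hn
      | cons f l => exact h.2.1.symm
    | succ n => simpa using ih h.2 (by simpa using hn)

theorem IsPath.rng_getElem_last {u w : V} {l : List E} (h : G.IsPath u l w) {n : ℕ}
    (hn : n + 1 = l.length) : G.rng l[n] = w := by
  induction l generalizing u n with
  | nil => simp at hn
  | cons e l ih =>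
    cases n with
    | zero =>
      cases l with
      | nil => exact h.2
      | cons f l => simp at hn
    | succ n => simpa using ih h.2 (by simpa using hn)

theorem IsPath.src_getElem_zero {u w : V} {l : List E} (h : G.IsPath u l w)
    (hn : 0 < l.length) : G.src l[0] = u := by
  cases l with
  | nil => simp at hn
  | cons e l => exact h.1

theorem K1Cycle.rng_edgeAt (c : G.K1Cycle) (n : ℕ) :
    G.rng (c.edgeAt n) = G.src (c.edgeAt (n + 1)) := by
  have hpos := List.length_pos_of_ne_nil c.isCycle.1.1
  have hlt := Nat.mod_lt n hpos
  have hp := c.isCycle.1.2.1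
  unfold edgeAt
  rcases Nat.lt_or_ge (n % c.edges.length + 1) c.edges.length with h | h
  · rw [hp.rng_getElem h]
    congr 2
    rw [Nat.add_mod, Nat.mod_eq_of_lt (a := 1) (by omega), Nat.mod_eq_of_lt h]
  -- Wrap-around: the last edge returns to the base, which is the source of the edge at position 0.
  · have h' : n % c.edges.length + 1 = c.edges.length := by omega
    rw [hp.rng_getElem_last h', ← hp.src_getElem_zero hpos]
    congr 2
    rw [← Nat.mod_add_mod, h', Nat.mod_self]

theorem K1Cycle.src_edgeAt_zero (c : G.K1Cycle) : G.src (c.edgeAt 0) = c.base := by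
  have hpos := List.length_pos_of_ne_nil c.isCycle.1.1
  rw [← c.isCycle.1.2.1.src_getElem_zero hpos]
  simp [edgeAt]

theorem K1Cycle.edgeAt_mem (c : G.K1Cycle) (n : ℕ) : c.edgeAt n ∈ c.edges :=
  List.getElem_mem _

theorem K1Cycle.edgeAt_add_length (c : G.K1Cycle) (n : ℕ) :
    c.edgeAt (n + c.edges.length) = c.edgeAt n := by
  simp [edgeAt]

theorem K1Cycle.src_injOn (c : G.K1Cycle) {e f : E} (he : e ∈ c.edges) (hf : f ∈ c.edges)
    (h : G.src e = G.src f) : e = f :=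
  List.inj_on_of_nodup_map c.isCycle.2 he hf h

theorem K1Cycle.rng_mem_sources (c : G.K1Cycle) {e : E} (he : e ∈ c.edges) :
    G.rng e ∈ c.edges.map G.src := by
  obtain ⟨n, hn, rfl⟩ := List.getElem_of_mem he
  have := c.rng_edgeAt n
  simp only [edgeAt, Nat.mod_eq_of_lt hn] at this
  rw [this]
  exact List.mem_map_of_mem (List.getElem_mem _)

/-- If every edge leaving the cycle `c` ends in the hereditary set `S`, then a path starting on `c`
ends on `c` or in `S`. -/
theorem K1Cycle.mem_or_mem_of_isPath (c : G.K1Cycle) {S : Set V} (hS : G.IsHereditary S)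
    (hexit : ∀ f, G.src f ∈ c.edges.map G.src → f ∉ c.edges → G.rng f ∈ S) {u w : V} {l : List E}
    (hu : u ∈ c.edges.map G.src) (h : G.IsPath u l w) : w ∈ c.edges.map G.src ∨ w ∈ S := by
  induction l generalizing u with
  | nil => exact Or.inl (h ▸ hu)
  | cons e l ih =>
    obtain ⟨rfl, h⟩ := h
    by_cases he : e ∈ c.edges
    · exact ih (c.rng_mem_sources he) h
    · exact Or.inr (hS _ _ _ (hexit e hu he) h)

theorem K1Cycle.base_mem_sources (c : G.K1Cycle) : c.base ∈ c.edges.map G.src :=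
  c.src_edgeAt_zero ▸ List.mem_map_of_mem (c.edgeAt_mem 0)

end Paths

namespace Leavitt

variable {K V E : Type*} [Field K] [Fintype V] [Fintype E] {G : DirectedGraph V E}

/-! ### Relations for paths and ghost paths in the Leavitt path algebra. -/

section Relations

variable (K G)

/-- The quotient map from the free algebra. -/
noncomputable def mk : FreeAlgebra K (Generator V E) →ₐ[K] G.Leavitt K :=
  RingQuot.mkAlgHom K (LeavittRel K G)

theorem mk_rel {x y : FreeAlgebra K (Generator V E)} (h : LeavittRel K G x y) :
    mk K G x = mk K G y :=
  RingQuot.mkAlgHom_rel K h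

theorem mk_vertex (v : V) : mk K G (FreeAlgebra.ι K (.vertex v)) = vertex K G v := rfl

theorem mk_edge (e : E) : mk K G (FreeAlgebra.ι K (.edge e)) = edge K G e := rfl

theorem mk_ghost (e : E) : mk K G (FreeAlgebra.ι K (.ghost e)) = ghost K G e := rfl

theorem vertex_mul_self (v : V) : vertex K G v * vertex K G v = vertex K G v := by
  simpa only [map_mul, mk_vertex, mk_edge, mk_ghost] using mk_rel K G (.vertex_mul_self v)

theorem edge_mul_rng (e : E) : edge K G e * vertex K G (G.rng e) = edge K G e := by
  simpa only [map_mul, mk_vertex, mk_edge, mk_ghost] using mk_rel K G (.edge_mul_rng e)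

theorem src_mul_edge (e : E) : vertex K G (G.src e) * edge K G e = edge K G e := by
  simpa only [map_mul, mk_vertex, mk_edge, mk_ghost] using mk_rel K G (.src_mul_edge e)

theorem ghost_mul_src (e : E) : ghost K G e * vertex K G (G.src e) = ghost K G e := by
  simpa only [map_mul, mk_vertex, mk_edge, mk_ghost] using mk_rel K G (.ghost_mul_src e)

theorem rng_mul_ghost (e : E) : vertex K G (G.rng e) * ghost K G e = ghost K G e := by
  simpa only [map_mul, mk_vertex, mk_edge, mk_ghost] using mk_rel K G (.rng_mul_ghost e)

theorem ghost_mul_edge_self (e : E) : ghost K G e * edge K G e = vertex K G (G.rng e) := by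
  simpa only [map_mul, mk_vertex, mk_edge, mk_ghost] using mk_rel K G (.ck1_self e)

theorem ghost_mul_edge_of_ne {e f : E} (h : e ≠ f) : ghost K G e * edge K G f = 0 := by
  simpa only [map_mul, map_zero, mk_edge, mk_ghost] using mk_rel K G (.ck1_of_ne e f h)

variable {K G}

theorem path_cons (e : E) (l : List E) :
    path K G (G.src e) (e :: l) = edge K G e * path K G (G.rng e) l := by
  simp only [path, List.map_cons, List.prod_cons, ← mul_assoc, src_mul_edge, edge_mul_rng]

theorem ghostPath_cons (e : E) (l : List E) :
    ghostPath K G (G.src e) (e :: l) = ghostPath K G (G.rng e) l * ghost K G e := by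
  simp only [ghostPath, List.map_cons, List.reverse_cons, List.prod_append, List.prod_cons,
    List.prod_nil, mul_one, mul_assoc, ghost_mul_src, rng_mul_ghost]

theorem vertex_mul_path (u : V) (l : List E) : vertex K G u * path K G u l = path K G u l := by
  rw [path, ← mul_assoc, vertex_mul_self]

theorem path_mul_path {u v : V} {α : List E} (h : G.IsPath u α v) (β : List E) :
    path K G u α * path K G v β = path K G u (α ++ β) := by
  induction α generalizing u with
  | nil => obtain rfl := h; simpa [path] using vertex_mul_path u β
  | cons e α ih => obtain ⟨rfl, h⟩ := h; rw [path_cons, mul_assoc, ih h, ← path_cons]; rfl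

theorem ghostPath_mul_path {u v : V} {α : List E} (h : G.IsPath u α v) :
    ghostPath K G u α * path K G u α = vertex K G v := by
  induction α generalizing u with
  | nil => obtain rfl := h; simp [path, ghostPath, vertex_mul_self]
  | cons e α ih =>
    obtain ⟨rfl, h⟩ := h
    rw [path_cons, ghostPath_cons, mul_assoc, ← mul_assoc (ghost K G e), ghost_mul_edge_self,
      vertex_mul_path, ih h]

end Relations

/-! ### Polynomials in closed paths, and the ideals of $K[x]$ they define. -/

section CyclePolynomials

/-- `p(l)` for a closed path `l` based at `v`, with `l⁰ = v`. -/
noncomputable def evalPath (v : V) (l : List E) (p : K[X]) : G.Leavitt K :=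
  vertex K G v * aeval (path K G v l) p

theorem evalPath_one (v : V) (l : List E) : evalPath v l (1 : K[X]) = vertex K G v := by
  simp [evalPath]

theorem vertex_mul_evalPath (v : V) (l : List E) (p : K[X]) :
    vertex K G v * evalPath v l p = evalPath v l p := by
  rw [evalPath, ← mul_assoc, vertex_mul_self]

/-- Since $\alpha(\beta\alpha)=(\alpha\beta)\alpha$, the path $\alpha$ intertwines the two rotations
and all their polynomials. -/
theorem path_mul_aeval {u w : V} {α β : List E} (hα : G.IsPath u α w) (hβ : G.IsPath w β u)
    (p : K[X]) : path K G u α * aeval (path K G w (β ++ α)) p =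
      aeval (path K G u (α ++ β)) p * path K G u α := by
  have hsemi : SemiconjBy (path K G u α) (path K G w (β ++ α)) (path K G u (α ++ β)) := by
    rw [SemiconjBy, path_mul_path hα, path_mul_path (isPath_append.2 ⟨_, hα, hβ⟩),
      List.append_assoc]
  induction p using Polynomial.induction_on' with
  | add p q hp hq => rw [map_add, map_add, mul_add, add_mul, hp, hq]
  | monomial n a =>
    rw [aeval_monomial, aeval_monomial, ← mul_assoc, ← Algebra.commutes, mul_assoc,
      (hsemi.pow_right n).eq, mul_assoc]

theorem vertex_mul_aeval {v : V} {l : List E} (h : G.IsPath v l v) (p : K[X]) :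
    vertex K G v * aeval (path K G v l) p = aeval (path K G v l) p * vertex K G v := by
  simpa [path] using path_mul_aeval (K := K) (u := v) (w := v) (α := []) rfl h p

theorem evalPath_mul {v : V} {l : List E} (h : G.IsPath v l v) (p q : K[X]) :
    evalPath v l (p * q) = aeval (path K G v l) p * evalPath v l q := by
  rw [evalPath, evalPath, map_mul, ← mul_assoc, ← mul_assoc, vertex_mul_aeval h]

theorem ghostPath_mul_evalPath_mul_path {u w : V} {α β : List E} (hα : G.IsPath u α w)
    (hβ : G.IsPath w β u) (p : K[X]) :
    ghostPath K G u α * evalPath u (α ++ β) p * path K G u α = evalPath w (β ++ α) p := by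
  rw [evalPath, mul_assoc, mul_assoc, ← path_mul_aeval hα hβ, ← mul_assoc (vertex K G u),
    vertex_mul_path, ← mul_assoc, ghostPath_mul_path hα, evalPath]

variable {I : TwoSidedIdeal (G.Leavitt K)}

theorem evalPath_rotate_mem {u w : V} {α β : List E} (hα : G.IsPath u α w)
    (hβ : G.IsPath w β u) {p : K[X]} (h : evalPath u (α ++ β) p ∈ I) :
    evalPath w (β ++ α) p ∈ I := by
  rw [← ghostPath_mul_evalPath_mul_path hα hβ]
  exact I.mul_mem_right _ _ (I.mul_mem_left _ _ h)

theorem evalCycle_mem_of_isRotated {c d : G.K1Cycle} (h : c.edges.IsRotated d.edges) {p : K[X]}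
    (hp : evalCycle c p ∈ I) : evalCycle d p ∈ I := by
  obtain ⟨α, β, hc, hd, hα, hβ⟩ := K1Cycle.exists_split_of_isRotated h
  change evalPath c.base c.edges p ∈ I at hp
  change evalPath d.base d.edges p ∈ I
  rw [hc] at hp
  rw [hd]
  exact evalPath_rotate_mem hα hβ hp

theorem evalCycle_one (c : G.K1Cycle) : evalCycle c (1 : K[X]) = vertex K G c.base :=
  evalPath_one _ _

variable (I) in
/-- The ideal of the polynomials `p` with `p(c) ∈ I`. -/
def polyIdeal (c : G.K1Cycle) : Ideal K[X] where
  carrier := {p | evalCycle c p ∈ I}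
  zero_mem' := by simp [evalCycle, I.zero_mem]
  add_mem' {p q} hp hq := by
    simpa [evalCycle, mul_add] using I.add_mem hp hq
  smul_mem' p q hq := by
    have := evalPath_mul (K := K) c.isCycle.1.2.1 p q
    exact (congrArg (· ∈ I) this).mpr (I.mul_mem_left _ _ hq)

theorem mem_polyIdeal {c : G.K1Cycle} {p : K[X]} : p ∈ polyIdeal I c ↔ evalCycle c p ∈ I :=
  Iff.rfl

/-- The ghost path cancels one factor of the cycle: $c^*\,c\,p(c)=p(c)$. This is what gives
generators a nonzero constant term. -/
theorem mem_polyIdeal_of_X_mul_mem {c : G.K1Cycle} {p : K[X]} (h : X * p ∈ polyIdeal I c) :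
    p ∈ polyIdeal I c := by
  have hc := c.isCycle.1.2.1
  have h' : evalPath c.base c.edges (X * p) ∈ I := h
  rw [evalPath_mul hc, aeval_X] at h'
  have := I.mul_mem_left (ghostPath K G c.base c.edges) _ h'
  rwa [← mul_assoc, ghostPath_mul_path hc, vertex_mul_evalPath] at this

theorem base_mem_of_one_mem {c : G.K1Cycle} (h : 1 ∈ polyIdeal I c) : c.base ∈ vertexSet I := by
  rwa [mem_polyIdeal, evalCycle_one] at h

theorem evalCycle_mem_of_base_mem {c : G.K1Cycle} (h : c.base ∈ vertexSet I) (p : K[X]) :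
    evalCycle c p ∈ I :=
  I.mul_mem_right _ _ h

variable (I) in
theorem isHereditary_vertexSet : G.IsHereditary (vertexSet I) := by
  intro u w l hu h
  change vertex K G w ∈ I
  rw [← ghostPath_mul_path h, ← vertex_mul_path, ← mul_assoc]
  exact I.mul_mem_right _ _ (I.mul_mem_left _ _ hu)

/-- Positive powers of the closed path begin with $g$ and die because $f^*g=0$; the constant term
leaves $f^*f=r(f)$. -/
theorem ghost_mul_evalPath_mul_edge {f g : E} (hfg : f ≠ g) (hs : G.src f = G.src g)
    (l : List E) (p : K[X]) :
    ghost K G f * evalPath (G.src g) (g :: l) p * edge K G f =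
      p.coeff 0 • vertex K G (G.rng f) := by
  have h0 : ghost K G f * path K G (G.src g) (g :: l) = 0 := by
    rw [path_cons, ← mul_assoc, ghost_mul_edge_of_ne K G hfg, zero_mul]
  rw [evalPath, ← mul_assoc, ← hs, ghost_mul_src, hs]
  conv_lhs => rw [← X_mul_divX_add p]
  rw [map_add, map_mul, aeval_X, mul_add, ← mul_assoc, h0, zero_mul, zero_add, aeval_C,
    ← Algebra.commutes, ← Algebra.smul_def, smul_mul_assoc, ghost_mul_edge_self]

/-- If `p(c) ∈ I` and `p(0) ≠ 0`, then the exits of `c` lead into `I`. -/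
theorem rng_exit_mem {c : G.K1Cycle} {p : K[X]} (hp : evalCycle c p ∈ I) (h0 : p.coeff 0 ≠ 0)
    {f : E} (hf : G.src f ∈ c.edges.map G.src) (hfc : f ∉ c.edges) : G.rng f ∈ vertexSet I := by
  obtain ⟨g, hg, hgf⟩ := List.mem_map.1 hf
  obtain ⟨α, β, hsplit⟩ := List.append_of_mem hg
  have hc := c.isCycle.1.2.1
  change evalPath c.base c.edges p ∈ I at hp
  rw [hsplit] at hp hc
  obtain ⟨w, h₁, h₂⟩ := isPath_append.1 hc
  -- Rotate the cycle so that it starts with the edge `g` having the same source as the exit `f`.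
  have hmem := evalPath_rotate_mem h₁ h₂ hp
  obtain rfl := h₂.1
  have hne : f ≠ g := fun h => hfc (h ▸ hg)
  have := I.mul_mem_right _ (edge K G f) (I.mul_mem_left (ghost K G f) _ hmem)
  rw [List.cons_append, ghost_mul_evalPath_mul_edge hne hgf.symm] at this
  have h := I.mul_mem_left (algebraMap K (G.Leavitt K) (p.coeff 0)⁻¹) _ this
  rwa [← Algebra.smul_def, smul_smul, inv_mul_cancel₀ h0, one_smul] at h

end CyclePolynomials

end Leavitt

/-! ### A weighted representation on functions on infinite paths. -/

section Representation

variable {V E : Type*}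

/-- The infinite paths of `G` all of whose vertices have a path to `b`. -/
def InfinitePath (G : DirectedGraph V E) (b : V) : Type _ :=
  {x : ℕ → E // ∀ n, G.rng (x n) = G.src (x (n + 1)) ∧ ∃ l, G.IsPath (G.src (x n)) l b}

namespace InfinitePath

variable {G : DirectedGraph V E} {b : V}

def tail (x : G.InfinitePath b) : G.InfinitePath b :=
  ⟨fun n => x.1 (n + 1), fun n => x.2 (n + 1)⟩

def cons (e : E) (x : G.InfinitePath b) (h : G.rng e = G.src (x.1 0)) : G.InfinitePath b :=
  ⟨fun n => n.casesOn e x.1, fun n => by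
    cases n with
    | zero =>
      obtain ⟨l, hl⟩ := (x.2 0).2
      exact ⟨h, e :: l, rfl, by rwa [h]⟩
    | succ n => exact x.2 n⟩

theorem tail_cons (e : E) (x : G.InfinitePath b) (h) : (x.cons e h).tail = x := rfl

theorem cons_zero (e : E) (x : G.InfinitePath b) (h) : (x.cons e h).1 0 = e := rfl

theorem tail_zero (x : G.InfinitePath b) : G.src (x.tail.1 0) = G.rng (x.1 0) := (x.2 0).1.symm

theorem cons_tail (x : G.InfinitePath b) {e : E} (he : x.1 0 = e) (h) : x.tail.cons e h = x := by
  apply Subtype.ext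
  funext n
  cases n with
  | zero => exact he.symm
  | succ n => rfl

theorem tail_iterate_apply (x : G.InfinitePath b) (k n : ℕ) :
    (tail^[k] x).1 n = x.1 (n + k) := by
  induction k generalizing x with
  | zero => rfl
  | succ k ih =>
    rw [Function.iterate_succ_apply, ih]
    exact congrArg x.1 (by omega)

end InfinitePath

variable (K : Type*) [Field K] (G : DirectedGraph V E) (b : V) {A : Type*} [CommRing A]
  [Algebra K A] (wt : E → Aˣ)

open scoped Classical in
/-- The action of the generators on functions on infinite paths, with edge `e` weighted by `wt e`. -/
noncomputable def genAction : Generator V E → Module.End K (G.InfinitePath b → A)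
  | .vertex v =>
    { toFun f x := if G.src (x.1 0) = v then f x else 0
      map_add' f g := by ext x; dsimp only [Pi.add_apply]; split_ifs <;> simp
      map_smul' a f := by ext x; dsimp only [Pi.smul_apply, RingHom.id_apply]; split_ifs <;> simp }
  | .edge e =>
    { toFun f x := if x.1 0 = e then wt e * f x.tail else 0
      map_add' f g := by ext x; dsimp only [Pi.add_apply]; split_ifs <;> simp [mul_add]
      map_smul' a f := by ext x; dsimp only [Pi.smul_apply, RingHom.id_apply]; split_ifs <;> simp }
  | .ghost e =>
    { toFun f x := if h : G.rng e = G.src (x.1 0) then ↑(wt e)⁻¹ * f (x.cons e h) else 0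
      map_add' f g := by ext x; dsimp only [Pi.add_apply]; split_ifs <;> simp [mul_add]
      map_smul' a f := by ext x; dsimp only [Pi.smul_apply, RingHom.id_apply]; split_ifs <;> simp }

variable {K G b}

open scoped Classical in
theorem genAction_vertex (v : V) (f : G.InfinitePath b → A) (x : G.InfinitePath b) :
    genAction K G b wt (.vertex v) f x = if G.src (x.1 0) = v then f x else 0 := rfl

open scoped Classical in
theorem genAction_edge (e : E) (f : G.InfinitePath b → A) (x : G.InfinitePath b) :
    genAction K G b wt (.edge e) f x = if x.1 0 = e then wt e * f x.tail else 0 := rfl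

open scoped Classical in
theorem genAction_ghost (e : E) (f : G.InfinitePath b → A) (x : G.InfinitePath b) :
    genAction K G b wt (.ghost e) f x =
      if h : G.rng e = G.src (x.1 0) then ↑(wt e)⁻¹ * f (x.cons e h) else 0 := rfl

variable [Fintype V] [Fintype E]

theorem lift_genAction_rel {p q : FreeAlgebra K (Generator V E)} (h : LeavittRel K G p q) :
    FreeAlgebra.lift K (genAction K G b wt) p = FreeAlgebra.lift K (genAction K G b wt) q := by
  classical
  refine LinearMap.ext fun f => funext fun x => ?_
  cases h with
  | one =>
    simp [FreeAlgebra.lift_ι_apply, LinearMap.sum_apply, Finset.sum_apply, genAction_vertex]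
  | vertex_mul_self v =>
    simp only [map_mul, FreeAlgebra.lift_ι_apply, Module.End.mul_apply, genAction_vertex]
    split_ifs <;> rfl
  | vertex_mul_of_ne v w h =>
    simp only [map_mul, map_zero, FreeAlgebra.lift_ι_apply, Module.End.mul_apply,
      genAction_vertex]
    split_ifs with h₁ h₂
    · exact absurd (h₁.symm.trans h₂) h
    · rfl
    · rfl
  | edge_mul_rng e =>
    simp only [map_mul, FreeAlgebra.lift_ι_apply, Module.End.mul_apply, genAction_vertex,
      genAction_edge, InfinitePath.tail_zero]
    split_ifs with h₁ h₂
    · rfl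
    · exact absurd (congrArg G.rng h₁) h₂
    · rfl
  | src_mul_edge e =>
    simp only [map_mul, FreeAlgebra.lift_ι_apply, Module.End.mul_apply, genAction_vertex,
      genAction_edge]
    split_ifs with h₁ h₂ h₂
    · rfl
    · rfl
    · exact absurd (congrArg G.src h₂) h₁
    · rfl
  | ghost_mul_src e =>
    simp only [map_mul, FreeAlgebra.lift_ι_apply, Module.End.mul_apply, genAction_vertex,
      genAction_ghost, InfinitePath.cons_zero, if_true]
  | rng_mul_ghost e =>
    simp only [map_mul, FreeAlgebra.lift_ι_apply, Module.End.mul_apply, genAction_vertex,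
      genAction_ghost]
    split_ifs with h₁ h₂ h₂
    · rfl
    · rfl
    · exact absurd h₂.symm h₁
    · rfl
  | ck1_self e =>
    simp only [map_mul, FreeAlgebra.lift_ι_apply, Module.End.mul_apply, genAction_vertex,
      genAction_ghost, genAction_edge, InfinitePath.cons_zero, if_true, InfinitePath.tail_cons,
      Units.inv_mul_cancel_left, dite_eq_ite, eq_comm]
  | ck1_of_ne e f' h =>
    simp only [map_mul, map_zero, FreeAlgebra.lift_ι_apply, Module.End.mul_apply, genAction_ghost]
    split_ifs with h₁
    · have h₂ : (x.cons e h₁).1 0 ≠ f' := h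
      rw [genAction_edge, if_neg h₂, mul_zero]
      rfl
    · rfl
  | ck2 v h =>
    -- $ee^*$ is the projection onto paths with first edge $e$: the weights cancel, and removing
    -- then restoring $e$ gives back `x`.
    have key (e : E) : genAction K G b wt (.edge e) (genAction K G b wt (.ghost e) f) x =
        if x.1 0 = e then f x else 0 := by
      rw [genAction_edge]
      split_ifs with he
      · have hr : G.rng e = G.src (x.tail.1 0) := by rw [InfinitePath.tail_zero, he]
        rw [genAction_ghost, dif_pos hr, Units.mul_inv_cancel_left, x.cons_tail he]
      · rfl
    simp only [map_sum, map_mul, FreeAlgebra.lift_ι_apply, LinearMap.sum_apply,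
      Module.End.mul_apply, Finset.sum_apply, key, genAction_vertex]
    rw [Finset.sum_ite_eq]
    simp

namespace Leavitt

variable (K G b) in
/-- The representation of `L_K(G)` on functions on infinite paths. -/
noncomputable def action : G.Leavitt K →ₐ[K] Module.End K (G.InfinitePath b → A) :=
  RingQuot.liftAlgHom K
    ⟨FreeAlgebra.lift K (genAction K G b wt), fun _ _ h => lift_genAction_rel wt h⟩

theorem action_gen (g : Generator V E) :
    action K G b wt (gen K G g) = genAction K G b wt g := by
  refine (RingQuot.liftAlgHom_mkAlgHom_apply K _ _ _).trans ?_
  exact FreeAlgebra.lift_ι_apply _ _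

theorem action_vertex_apply_of_ne {v : V} {x : G.InfinitePath b} (h : G.src (x.1 0) ≠ v)
    (f : G.InfinitePath b → A) : action K G b wt (vertex K G v) f x = 0 := by
  rw [vertex, action_gen, genAction_vertex, if_neg h]

theorem action_vertex_apply_self {v : V} {x : G.InfinitePath b} (h : G.src (x.1 0) = v)
    (f : G.InfinitePath b → A) : action K G b wt (vertex K G v) f x = f x := by
  rw [vertex, action_gen, genAction_vertex, if_pos h]

theorem action_edges_apply (l : List E) {x : G.InfinitePath b}
    (h : ∀ n (hn : n < l.length), x.1 n = l[n]) (f : G.InfinitePath b → A) :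
    action K G b wt (l.map (edge K G)).prod f x =
      (l.map wt).prod * f (InfinitePath.tail^[l.length] x) := by
  induction l generalizing x with
  | nil => simp
  | cons e l ih =>
    have h0 : x.1 0 = e := h 0 (by simp)
    rw [List.map_cons, List.prod_cons, map_mul, Module.End.mul_apply, edge, action_gen,
      genAction_edge, if_pos h0, ih (x := x.tail)
        (fun n hn => h (n + 1) (by simpa using hn))]
    simp [mul_assoc]

/-- At an infinite path fixed by the shift along its prefix `l`, `p(l)` acts as multiplication by
`p(u)`, where `u` is the weight of `l`. -/
theorem action_evalPath_apply {v : V} {l : List E} {x : G.InfinitePath b}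
    (hv : G.src (x.1 0) = v) (h : ∀ n (hn : n < l.length), x.1 n = l[n])
    (hx : InfinitePath.tail^[l.length] x = x) {u : A} (hu : ((l.map wt).prod : A) = u)
    (p : K[X]) (f : G.InfinitePath b → A) :
    action K G b wt (evalPath v l p) f x = aeval u p * f x := by
  have hpath (f : G.InfinitePath b → A) : action K G b wt (path K G v l) f x = u * f x := by
    rw [path, map_mul, Module.End.mul_apply, action_vertex_apply_self wt hv,
      action_edges_apply wt l h, hx, hu]
  rw [evalPath, map_mul, Module.End.mul_apply, action_vertex_apply_self wt hv]
  have hpow (n : ℕ) (f : G.InfinitePath b → A) :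
      action K G b wt (path K G v l ^ n) f x = u ^ n * f x := by
    induction n generalizing f with
    | zero => simp
    | succ n ih => rw [pow_succ, map_mul, Module.End.mul_apply, ih, hpath, pow_succ, mul_assoc]
  induction p using Polynomial.induction_on' with
  | add p q hp hq => simp [add_mul, hp, hq]
  | monomial n a =>
    rw [aeval_monomial, aeval_monomial, ← Algebra.smul_def, ← Algebra.smul_def, map_smul,
      LinearMap.smul_apply, Pi.smul_apply, hpow, smul_mul_assoc]

end Leavitt

end Representation

/-! ### Coefficient algebras with a unit of prescribed annihilator. -/

section CoefficientAlgebra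

/-- A commutative algebra with a unit `u` such that `q(u) = 0` if and only if `p ∣ q`. -/
theorem exists_unit_aeval_eq_zero_iff.{u} {K : Type u} [Field K] {p : K[X]}
    (hp : p = 0 ∨ p.coeff 0 ≠ 0) :
    ∃ (A : Type u) (_ : CommRing A) (_ : Algebra K A) (u : Aˣ),
      ∀ q : K[X], aeval (u : A) q = 0 ↔ p ∣ q := by
  rcases hp with rfl | hp
  -- For $p=0$ the unit must be transcendental; otherwise the root in $K[x]/(p)$ serves.
  · refine ⟨RatFunc K, inferInstance, inferInstance,
      Units.mk0 (RatFunc.X : RatFunc K) RatFunc.X_ne_zero, fun q => ?_⟩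
    rw [zero_dvd_iff, Units.val_mk0, ← RatFunc.algebraMap_X, aeval_algebraMap_apply, aeval_X_left_apply]
    exact map_eq_zero_iff _ (RatFunc.algebraMap_injective K)
  -- Modulo $p$, $x\cdot(p-p(0))/x=-p(0)$ is a nonzero scalar, so $x$ is invertible.
  · have hu : IsUnit (AdjoinRoot.root p) := by
      have h : AdjoinRoot.mk p (X * p.divX + C (p.coeff 0)) = 0 := by
        rw [X_mul_divX_add, AdjoinRoot.mk_self]
      rw [map_add, map_mul, AdjoinRoot.mk_X, AdjoinRoot.mk_C, add_eq_zero_iff_eq_neg] at h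
      refine isUnit_of_mul_isUnit_left (y := AdjoinRoot.mk p p.divX) ?_
      rw [h, ← map_neg]
      exact (IsUnit.mk0 _ (neg_ne_zero.2 hp)).map _
    refine ⟨AdjoinRoot p, inferInstance, inferInstance, hu.unit, fun q => ?_⟩
    rw [IsUnit.unit_spec, AdjoinRoot.aeval_eq, AdjoinRoot.mk_eq_zero]

end CoefficientAlgebra


/-! ### The periodic infinite path of a K1 cycle and its weight. -/

section InfinitePaths

variable {V E : Type*} {G : DirectedGraph V E}

namespace K1Cycle

/-- The infinite path `c c c ⋯`. -/
def infinitePath (c : G.K1Cycle) : G.InfinitePath c.base :=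
  ⟨c.edgeAt, fun n => ⟨c.rng_edgeAt n, by
    obtain ⟨α, β, h⟩ := List.append_of_mem (c.edgeAt_mem n)
    have hc := c.isCycle.1.2.1
    rw [h, isPath_append] at hc
    obtain ⟨w, -, h₂⟩ := hc
    obtain rfl := h₂.1
    exact ⟨_, h₂⟩⟩⟩

theorem infinitePath_apply (c : G.K1Cycle) (n : ℕ) (hn : n < c.edges.length) :
    c.infinitePath.1 n = c.edges[n] := by
  simp [infinitePath, edgeAt, Nat.mod_eq_of_lt hn]

theorem tail_iterate_infinitePath (c : G.K1Cycle) :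
    InfinitePath.tail^[c.edges.length] c.infinitePath = c.infinitePath :=
  Subtype.ext <| funext fun n =>
    (InfinitePath.tail_iterate_apply _ _ _).trans (c.edgeAt_add_length n)

/-- If the exits of `c` lead to vertices without a path to `c.base`, then `c c c ⋯` is the only
infinite path from `c.base` staying connected to `c.base`. -/
theorem eq_infinitePath (c : G.K1Cycle) {S : Set V} (hS : G.IsHereditary S) (hb : c.base ∉ S)
    (hexit : ∀ f, G.src f ∈ c.edges.map G.src → f ∉ c.edges → G.rng f ∈ S)
    {x : G.InfinitePath c.base} (hx : G.src (x.1 0) = c.base) : x = c.infinitePath := by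
  -- Leaving the cycle would put the next vertex in `S`; it still connects to the base, which would
  -- then lie in `S`.
  have step (n : ℕ) (h : G.src (x.1 n) = G.src (c.edgeAt n)) : x.1 n = c.edgeAt n := by
    refine c.src_injOn ?_ (c.edgeAt_mem n) h
    by_contra hn
    have hr := hexit (x.1 n) (h ▸ List.mem_map_of_mem (c.edgeAt_mem n)) hn
    rw [(x.2 n).1] at hr
    obtain ⟨l, hl⟩ := (x.2 (n + 1)).2
    exact hb (hS _ _ _ hr hl)
  refine Subtype.ext (funext fun n => ?_)
  change x.1 n = c.edgeAt n
  induction n with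
  | zero => exact step 0 (hx.trans c.src_edgeAt_zero.symm)
  | succ n ih => exact step _ (by rw [← (x.2 n).1, ih, c.rng_edgeAt])

open scoped Classical in
/-- The weight that is `u` on the first edge of `c` and `1` elsewhere. -/
noncomputable def weight {M : Type*} [CommMonoid M] (c : G.K1Cycle) (u : M) (e : E) : M :=
  if e = c.edgeAt 0 then u else 1

theorem prod_weight {M : Type*} [CommMonoid M] (c : G.K1Cycle) (u : M) :
    (c.edges.map (c.weight u)).prod = u := by
  classical
  rw [List.prod_map_eq_pow_single (c.edgeAt 0) (c.weight u) fun e he _ => if_neg he,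
    List.count_eq_one_of_mem c.isCycle.2.of_map (c.edgeAt_mem 0), pow_one]
  exact if_pos rfl

end K1Cycle

end InfinitePaths

variable {K V E : Type*} [Field K] [Fintype V] [Fintype E] {G : DirectedGraph V E}

/-! ### Uniqueness of λ-reductions and the order on ideals. -/

namespace IsLambdaReduction

open Leavitt

variable {m : ℕ} {lam : Fin m → G.K1Cycle} {I : TwoSidedIdeal (G.Leavitt K)}
  {D : LambdaData K V m}

theorem coeff_zero (hD : IsLambdaReduction lam I D) (i : Fin m) :
    D.poly i = 0 ∨ (D.poly i).coeff 0 ≠ 0 :=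
  (hD.poly_spec i).imp_right fun h => h.2.1

theorem evalCycle_poly_mem (hD : IsLambdaReduction lam I D) (i : Fin m) :
    evalCycle (lam i) (D.poly i) ∈ I := by
  rw [hD.span_eq]
  exact TwoSidedIdeal.subset_span (Or.inl ⟨i, rfl⟩)

theorem rng_exit_mem (hD : IsLambdaReduction lam I D) {i : Fin m} (hi : D.poly i ≠ 0) (f : E)
    (hf : G.src f ∈ (lam i).edges.map G.src) (hfc : f ∉ (lam i).edges) :
    G.rng f ∈ vertexSet I :=
  Leavitt.rng_exit_mem (hD.evalCycle_poly_mem i) ((hD.coeff_zero i).resolve_left hi) hf hfc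

/-- The ideal lies in the kernel of the representation attached to $\lambda_i$ and $u$, while
$p(\lambda_i)$ acts as $p(u)$ at the periodic path. -/
theorem dvd_of_evalCycle_mem (hlam : G.ListsK1Cycles lam) (hD : IsLambdaReduction lam I D)
    {i : Fin m} (hb : (lam i).base ∉ vertexSet I) {p : K[X]} (hp : evalCycle (lam i) p ∈ I) :
    D.poly i ∣ p := by
  obtain ⟨A, _, _, u, hu⟩ := exists_unit_aeval_eq_zero_iff (hD.coeff_zero i)
  have hS := isHereditary_vertexSet I
  have hprod : (((lam i).edges.map ((lam i).weight u)).prod : A) = u := by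
    rw [(lam i).prod_weight]
  have hact := action_evalPath_apply (K := K) ((lam i).weight u) (lam i).src_edgeAt_zero
    (lam i).infinitePath_apply (lam i).tail_iterate_infinitePath hprod
  have hker : I ≤ TwoSidedIdeal.ker (action K G (lam i).base ((lam i).weight u)) := by
    rw [hD.span_eq, TwoSidedIdeal.span_le]
    rintro _ (⟨j, rfl⟩ | ⟨v, hv, rfl⟩) <;>
      refine (TwoSidedIdeal.mem_ker _).2 (LinearMap.ext fun f => funext fun x => ?_)
    · by_cases hx : G.src (x.1 0) = (lam j).base
      · by_cases hj : D.poly j = 0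
        · simp [evalCycle, hj]
        obtain ⟨l, hl⟩ := (x.2 0).2
        rw [hx] at hl
        -- The base of $\lambda_i$ is reachable from $\lambda_j$ and not in $I$, so it lies on
        -- $\lambda_j$. The cycles are then rotations of each other.
        obtain rfl : i = j := by
          have h := (K1Cycle.mem_or_mem_of_isPath _ hS (hD.rng_exit_mem hj)
            (lam j).base_mem_sources hl).resolve_right hb
          exact (hlam (lam i)).unique (List.IsRotated.refl _) (K1Cycle.isRotated_of_base_mem h)
        rw [K1Cycle.eq_infinitePath _ hS hb (hD.rng_exit_mem hj) hx]
        refine (hact _ _).trans ?_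
        rw [(hu _).2 dvd_rfl, zero_mul]
        rfl
      · simp only [evalCycle, map_mul, Module.End.mul_apply]
        exact action_vertex_apply_of_ne _ hx _
    · refine action_vertex_apply_of_ne _ ?_ _
      rintro rfl
      obtain ⟨l, hl⟩ := (x.2 0).2
      rw [hD.vertices_eq] at hv
      exact hb (hS _ _ _ hv hl)
  have h0 := (TwoSidedIdeal.mem_ker _).1 (hker hp)
  rw [← hu]
  -- Evaluating on the constant function 1 reads off $p(u)=0$.
  have h1 := hact p 1
  rw [show evalPath (lam i).base (lam i).edges p = evalCycle (lam i) p from rfl, h0] at h1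
  simpa using h1.symm

theorem evalCycle_mem_iff (hlam : G.ListsK1Cycles lam) (hD : IsLambdaReduction lam I D)
    {i : Fin m} (hb : (lam i).base ∉ vertexSet I) {p : K[X]} :
    evalCycle (lam i) p ∈ I ↔ D.poly i ∣ p := by
  refine ⟨hD.dvd_of_evalCycle_mem hlam hb, ?_⟩
  rintro ⟨q, rfl⟩
  exact mem_polyIdeal.1 (Ideal.mul_mem_right q (polyIdeal I (lam i)) (hD.evalCycle_poly_mem i))

theorem poly_eq_zero_of_base_mem (hD : IsLambdaReduction lam I D) {i : Fin m}
    (hb : (lam i).base ∈ vertexSet I) : D.poly i = 0 :=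
  (hD.poly_spec i).resolve_right fun h => h.2.2.2 (hD.vertices_eq ▸ hb)

/-- Off $I$, both polynomials generate the same ideal of $K[x]$, so they divide each other; monicity
removes the unit. -/
theorem eq (hlam : G.ListsK1Cycles lam) {D' : LambdaData K V m} (hD : IsLambdaReduction lam I D)
    (hD' : IsLambdaReduction lam I D') : D = D' := by
  have hv : D.vertices = D'.vertices := hD.vertices_eq.trans hD'.vertices_eq.symm
  have hp : D.poly = D'.poly := by
    funext i
    by_cases hb : (lam i).base ∈ vertexSet I
    · rw [hD.poly_eq_zero_of_base_mem hb, hD'.poly_eq_zero_of_base_mem hb]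
    have h₁ : D.poly i ∣ D'.poly i := (hD.evalCycle_mem_iff hlam hb).1 (hD'.evalCycle_poly_mem i)
    have h₂ : D'.poly i ∣ D.poly i := (hD'.evalCycle_mem_iff hlam hb).1 (hD.evalCycle_poly_mem i)
    rcases hD.poly_spec i with h | h
    · rw [h] at h₁ ⊢
      exact (zero_dvd_iff.1 h₁).symm
    rcases hD'.poly_spec i with h' | h'
    · rw [h'] at h₂ ⊢
      exact zero_dvd_iff.1 h₂
    exact eq_of_monic_of_associated h.1 h'.1 (associated_of_dvd_dvd h₁ h₂)
  cases D
  cases D'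
  congr

theorem le_iff_dvd (hlam : G.ListsK1Cycles lam) {I' : TwoSidedIdeal (G.Leavitt K)}
    {D' : LambdaData K V m} (hD : IsLambdaReduction lam I D) (hD' : IsLambdaReduction lam I' D')
    (h : D.vertices = D'.vertices) : I ≤ I' ↔ ∀ i, D'.poly i ∣ D.poly i := by
  have hv : vertexSet I = vertexSet I' := by rw [← hD.vertices_eq, ← hD'.vertices_eq, h]
  constructor
  · intro hle i
    by_cases hb : (lam i).base ∈ vertexSet I
    · rw [hD.poly_eq_zero_of_base_mem hb]
      exact dvd_zero _
    · exact (hD'.evalCycle_mem_iff hlam (hv ▸ hb)).1 (hle (hD.evalCycle_poly_mem i))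
  · intro hdvd
    rw [hD.span_eq, TwoSidedIdeal.span_le]
    rintro _ (⟨i, rfl⟩ | ⟨v, hv', rfl⟩)
    · by_cases hb : (lam i).base ∈ vertexSet I'
      · exact evalCycle_mem_of_base_mem hb _
      · exact (hD'.evalCycle_mem_iff hlam hb).2 (hdvd i)
    · rw [h, hD'.vertices_eq] at hv'
      exact hv'

end IsLambdaReduction

/-! ### Existence of λ-reductions. -/

namespace Leavitt

/-- The ideal of the polynomials `p` with `p(c) ∈ I` has a generator as required of a
`λ`-reduction. -/
theorem exists_generator_polyIdeal (I : TwoSidedIdeal (G.Leavitt K)) (c : G.K1Cycle)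
    (hb : c.base ∉ vertexSet I) :
    ∃ p : K[X], (p = 0 ∨ (p.Monic ∧ p.coeff 0 ≠ 0 ∧ 0 < p.natDegree)) ∧
      polyIdeal I c = Ideal.span {p} := by
  classical
  obtain ⟨g, hg⟩ := IsPrincipalIdealRing.principal (polyIdeal I c)
  have hg' : polyIdeal I c = Ideal.span {normalize g} :=
    hg.trans (Ideal.span_singleton_eq_span_singleton.2 (associated_normalize g))
  refine ⟨normalize g, ?_, hg'⟩
  by_cases h0 : g = 0
  · simp [h0]
  have hmonic : (normalize g).Monic := monic_normalize h0
  have hmem {q : K[X]} : q ∈ polyIdeal I c ↔ normalize g ∣ q := by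
    rw [hg', Ideal.mem_span_singleton]
  refine Or.inr ⟨hmonic, fun hc => ?_, Nat.pos_of_ne_zero fun hdeg => ?_⟩
  -- If the generator were $xq$, then $q$ would lie in the ideal too and be a multiple of $xq$,
  -- against degrees.
  · obtain ⟨q, hq⟩ := X_dvd_iff.2 hc
    have hdvd : normalize g ∣ q := hmem.1 (mem_polyIdeal_of_X_mul_mem (hq ▸ hmem.2 dvd_rfl))
    have hq0 : q ≠ 0 := by
      rintro rfl
      exact hmonic.ne_zero (by simpa using hq)
    have hle := natDegree_le_of_dvd hdvd hq0
    rw [hq, natDegree_X_mul hq0] at hle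
    omega
  · refine hb (base_mem_of_one_mem (hmem.2 ?_))
    rw [hmonic.natDegree_eq_zero.1 hdeg]

theorem IsLambdaReducible.exists_isLambdaReduction {m : ℕ} {lam : Fin m → G.K1Cycle}
    (hlam : G.ListsK1Cycles lam) {I : TwoSidedIdeal (G.Leavitt K)} (hI : IsLambdaReducible I) :
    ∃ D : LambdaData K V m, IsLambdaReduction lam I D := by
  classical
  have hex (i : Fin m) : ∃ p : K[X], ((p = 0 ∨ (p.Monic ∧ p.coeff 0 ≠ 0 ∧ 0 < p.natDegree ∧
      (lam i).base ∉ vertexSet I)) ∧ evalCycle (lam i) p ∈ I) ∧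
      ((lam i).base ∉ vertexSet I → ∀ q : K[X], evalCycle (lam i) q ∈ I → p ∣ q) := by
    by_cases hb : (lam i).base ∈ vertexSet I
    -- When the base lies in $I$, every polynomial in $\lambda_i$ already follows from the vertices,
    -- and condition 1 forces $0$.
    · exact ⟨0, ⟨Or.inl rfl, evalCycle_mem_of_base_mem hb 0⟩, fun h => absurd hb h⟩
    · obtain ⟨p, hp, hpI⟩ := exists_generator_polyIdeal I (lam i) hb
      have hmem {q : K[X]} : evalCycle (lam i) q ∈ I ↔ p ∣ q := by
        rw [← mem_polyIdeal, hpI, Ideal.mem_span_singleton]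
      exact ⟨p, ⟨hp.imp_right fun h => ⟨h.1, h.2.1, h.2.2, hb⟩, hmem.2 dvd_rfl⟩,
        fun _ q => hmem.1⟩
  choose p hp hdvd using hex
  refine ⟨⟨vertexSet I, p⟩, rfl, fun i => (hp i).1, le_antisymm ?_ ?_⟩
  · set J := TwoSidedIdeal.span
      (Set.range (fun i => evalCycle (lam i) (p i)) ∪ vertex K G '' vertexSet I) with hJ
    have hvJ {v : V} (hv : v ∈ vertexSet I) : v ∈ vertexSet J :=
      TwoSidedIdeal.subset_span (Or.inr ⟨v, hv, rfl⟩)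
    obtain ⟨A, S, -, -, hspan⟩ := hI
    have hsub := TwoSidedIdeal.span_le.1 hspan.ge
    rw [hspan, TwoSidedIdeal.span_le]
    rintro _ (⟨⟨q, c⟩, hqc, rfl⟩ | ⟨v, hv, rfl⟩)
    · have hq : evalCycle c q ∈ I := hsub (Or.inl ⟨⟨q, c⟩, hqc, rfl⟩)
      obtain ⟨i, hi, -⟩ := hlam c
      -- The given generator may use another base vertex: pass to the listed rotation, where $q$ is
      -- a multiple of $p_i$ unless the base is in $I$.
      refine evalCycle_mem_of_isRotated (d := c) hi.symm ?_
      by_cases hb : (lam i).base ∈ vertexSet I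
      · exact evalCycle_mem_of_base_mem (hvJ hb) q
      · obtain ⟨r, hr⟩ := hdvd i hb q (evalCycle_mem_of_isRotated hi hq)
        rw [hr, ← mem_polyIdeal]
        exact Ideal.mul_mem_right r _ (TwoSidedIdeal.subset_span (Or.inl ⟨i, rfl⟩))
    · exact hvJ (hsub (Or.inr ⟨v, hv, rfl⟩))
  · rw [TwoSidedIdeal.span_le]
    rintro _ (⟨i, rfl⟩ | ⟨v, hv, rfl⟩)
    · exact (hp i).2
    · exact hv

theorem IsLambdaReducible.existsUnique_isLambdaReduction {m : ℕ} {lam : Fin m → G.K1Cycle}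
    (hlam : G.ListsK1Cycles lam) {I : TwoSidedIdeal (G.Leavitt K)} (hI : IsLambdaReducible I) :
    ∃! D : LambdaData K V m, IsLambdaReduction lam I D :=
  existsUnique_of_exists_of_unique (hI.exists_isLambdaReduction hlam)
    fun _ _ h h' => h.eq hlam h'

end Leavitt

end DirectedGraph

theorem mainTheorem5 {K V E : Type*} [Field K] [Fintype V] [Fintype E] (G : DirectedGraph V E)
    {m : ℕ} (lam : Fin m → G.K1Cycle) (hlam : G.ListsK1Cycles lam)
    (I I' : TwoSidedIdeal (G.Leavitt K))
    (hI : DirectedGraph.Leavitt.IsLambdaReducible I)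
    (hI' : DirectedGraph.Leavitt.IsLambdaReducible I')
    (hng : ¬ DirectedGraph.Leavitt.IsGraded I)
    (hng' : ¬ DirectedGraph.Leavitt.IsGraded I') :
    (∃! D : DirectedGraph.LambdaData K V m, DirectedGraph.IsLambdaReduction lam I D) ∧
    (∃! D' : DirectedGraph.LambdaData K V m, DirectedGraph.IsLambdaReduction lam I' D') ∧
    ∀ D D' : DirectedGraph.LambdaData K V m,
      DirectedGraph.IsLambdaReduction lam I D → DirectedGraph.IsLambdaReduction lam I' D' →
      D.vertices = D'.vertices →
      (I ≤ I' ↔ ∀ i, D'.poly i ∣ D.poly i) := by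
  refine ⟨hI.existsUnique_isLambdaReduction hlam, hI'.existsUnique_isLambdaReduction hlam, ?_⟩
  intro D D' hD hD' h
  exact hD.le_iff_dvd hlam hD' h
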